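/- Let $1\le k\le n$ be integers, let $e_1,\dots,e_n\in\mathbb{R}[X_1,\dots,X_n]$ be the elementary symmetric polynomials, and let $l_1,\dots,l_k\in\mathbb{R}[Z_1,\dots,Z_n]$ be linearly independent linear forms (homogeneous polynomials of degree $1$). A symmetric polynomial $f\in\mathbb{R}[X_1,\dots,X_n]$ is called \emph{$(l_1,\dots,l_k)$-sufficient} if $f=g(e_1,\dots,e_n)$ for some $g$ in the subalgebra $\mathbb{R}[l_1,\dots,l_k]\subseteq\mathbb{R}[Z_1,\dots,Z_n]$. For $m\in\mathbb{N}$ let $\mathcal{A}_m=\{x\in\mathbb{R}^n : |\{x_1,\dots,x_n\}|\le m\}$ be the set of points with at most $m$ distinct coordinates; $f$ is called \emph{$m$-complete} if $f(\mathbb{R}^n)=f(\mathcal{A}_m)$. Let $f\in\mathbb{R}[X_1,\dots,X_n]$ be an $(l_1,\dots,l_k)$-sufficient symmetric polynomial. Then 1. $f$ is $(k+1)$-complete; 2. if $Z_1\in\operatorname{span}_{\mathbb{R}}(l_1,\dots,l_k)$, then $f$ is $k$-complete. -/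

import Mathlib

namespace HyperbolicSlices

/-- `f = g(e₁, …, eₙ)` for some `g` in the subalgebra `ℝ[l₁, …, l_k]` of `ℝ[Z₁, …, Zₙ]`.
The variable `Z_{i+1}` is `X i` for `i : Fin n`, and it is replaced by `e_{i+1}`. -/
def IsSufficient {n k : ℕ} (l : Fin k → MvPolynomial (Fin n) ℝ)
    (f : MvPolynomial (Fin n) ℝ) : Prop :=
  ∃ g ∈ Algebra.adjoin ℝ (Set.range l),
    f = MvPolynomial.aeval (fun i : Fin n => MvPolynomial.esymm (Fin n) ℝ ((i : ℕ) + 1)) g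

/-- The set `𝒜_m` of points of `ℝⁿ` with at most `m` distinct coordinates. -/
def fewCoords (n m : ℕ) : Set (Fin n → ℝ) :=
  {x | (Set.range x).ncard ≤ m}

/-- `f(ℝⁿ) = f(𝒜_m)`. -/
def IsValueComplete {n : ℕ} (m : ℕ) (f : MvPolynomial (Fin n) ℝ) : Prop :=
  (fun x : Fin n → ℝ => MvPolynomial.eval x f) '' Set.univ =
    (fun x : Fin n → ℝ => MvPolynomial.eval x f) '' fewCoords n m

end HyperbolicSlices

/-!
The vector `(e₁(y), …, eₙ(y))` records the coefficients of the real-rooted polynomial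
`∏ (X - yᵢ)`, and a sufficient `f` is constant on the fibres of a linear map `L` evaluated at this
vector. If `y` has more than `rank L` distinct coordinates, the corresponding linear factors can be
perturbed by any polynomial of smaller degree without losing real-rootedness, and a dimension count
finds such a perturbation in `ker L`; hence `y` is not an extreme point of its fibre. A fibre on
which `e₁` is constant does have extreme points: there `∑ yᵢ² = e₁² - 2 e₂`, so the face where `e₂`
is maximal is compact and nonempty, and Krein-Milman applies. When `L` does not determine `e₁`, one
adds `e₁` to it, at the cost of one more distinct coordinate.
-/

namespace HyperbolicSlices

open Filter Finset Lagrange MvPolynomial Module Topology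

section Perturbation

variable {𝕜 ι : Type*} [NontriviallyNormedField 𝕜] [Finite ι] {s : Finset ι} {a : ι → 𝕜}

theorem hasStrictFDerivAt_eval_nodal {j : ι} (hj : j ∈ s) :
    HasStrictFDerivAt (fun b => (nodal s b).eval (a j))
      (-((nodal s a).derivative.eval (a j) • ContinuousLinearMap.proj (R := 𝕜) j)) a := by
  classical
  cases nonempty_fintype ι
  have hfactor (i : ι) : HasStrictFDerivAt (fun b : ι → 𝕜 => a j - b i)
      (-ContinuousLinearMap.proj (R := 𝕜) i) a :=
    (hasStrictFDerivAt_apply i a).const_sub (a j)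
  have hprod := HasStrictFDerivAt.finsetProd (u := s) fun i _ => hfactor i
  -- The `j`-th factor vanishes at `a`, so only the term differentiating it survives.
  have hvanish (i : ι) (hij : i ≠ j) : ∏ k ∈ s.erase i, (a j - a k) = 0 :=
    prod_eq_zero (mem_erase.2 ⟨hij.symm, hj⟩) (sub_self _)
  rw [sum_eq_single_of_mem j hj fun i _ hij => by rw [hvanish i hij]; module] at hprod
  simp only [eval_nodal, eval_nodal_derivative_eval_node_eq hj]
  exact hprod.congr_fderiv (smul_neg _ _)

theorem map_eval_nodal_nhds [CompleteSpace 𝕜] (ha : Set.InjOn a s) :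
    map (fun (b : ι → 𝕜) (j : s) => (nodal s b).eval (a j)) (𝓝 a) = 𝓝 0 := by
  cases nonempty_fintype ι
  have hderiv := hasStrictFDerivAt_pi.2 fun j : s => hasStrictFDerivAt_eval_nodal (a := a) j.2
  have hsurj : (ContinuousLinearMap.pi fun j : s => -((nodal s a).derivative.eval (a j) •
      ContinuousLinearMap.proj (R := 𝕜) (φ := fun _ : ι => 𝕜) (j : ι))).range = ⊤ := by
    classical
    refine LinearMap.range_eq_top.2 fun w => ⟨fun i => if hi : i ∈ s then
      -((nodal s a).derivative.eval (a i))⁻¹ * w ⟨i, hi⟩ else 0, ?_⟩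
    ext j
    have hne : (nodal s a).derivative.eval (a j) ≠ 0 := by
      apply inv_eq_zero.not.1
      rw [← nodalWeight_eq_eval_derivative_nodal j.2]
      exact nodalWeight_ne_zero ha j.2
    simp [hne]
  have hzero : (fun j : s => (nodal s a).eval (a j)) = 0 :=
    funext fun j => eval_nodal_at_node j.2
  rw [hderiv.map_nhds_eq_of_surj hsurj, hzero]

theorem eventually_exists_nodal_eq_add_smul [CompleteSpace 𝕜] (ha : Set.InjOn a s)
    {S : Polynomial 𝕜} (hS : S.degree < #s) :
    ∀ᶠ t in 𝓝 (0 : 𝕜), ∃ b : ι → 𝕜, nodal s b = nodal s a + t • S := by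
  have hlim : Tendsto (fun (t : 𝕜) (j : s) => t * S.eval (a j)) (𝓝 0) (𝓝 0) :=
    Continuous.tendsto' (by fun_prop) _ _ (by ext; simp)
  rw [← map_eval_nodal_nhds ha] at hlim
  filter_upwards [hlim range_mem_map] with t ⟨b, hb⟩
  refine ⟨b, Polynomial.eq_of_degree_sub_lt_of_eval_index_eq s ha ?_ fun j hj => ?_⟩
  · rw [← sub_sub]
    refine (Polynomial.degree_sub_le _ _).trans_lt (max_lt ?_
      ((Polynomial.degree_smul_le t S).trans_lt hS))
    simpa only [degree_nodal] using Polynomial.degree_sub_lt_left (p := nodal s b) (q := nodal s a)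
      (by simp only [degree_nodal]) nodal_ne_zero
      (by rw [nodal_monic.leadingCoeff, nodal_monic.leadingCoeff])
  · simpa [eval_nodal_at_node hj] using congrFun hb ⟨j, hj⟩

end Perturbation

section Vieta

variable {R : Type*} [CommRing R] {n : ℕ}

/-- The Vieta map `y ↦ (e₁(y), …, eₙ(y))`. The value `e_{i+1}(y)` has index `i : Fin n`. -/
noncomputable def vietaMap (y : Fin n → R) : Fin n → R :=
  fun i => eval y (esymm (Fin n) R (i + 1))

/-- The vector `(-c_{n-1}, c_{n-2}, …, (-1)ⁿ c₀)` of coefficients of a polynomial `∑ cⱼ Xʲ`. The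
leading coefficient of a monic polynomial of degree `n` is left out, so that the Vieta map factors
through this linear map. -/
noncomputable def signedCoeffs (R : Type*) [CommRing R] (n : ℕ) :
    Polynomial R →ₗ[R] (Fin n → R) :=
  LinearMap.pi fun i => (-1) ^ (i + 1 : ℕ) • Polynomial.lcoeff R i.rev

theorem signedCoeffs_nodal (y : Fin n → R) : signedCoeffs R n (nodal univ y) = vietaMap y := by
  ext i
  have hcoeff := Multiset.prod_X_sub_C_coeff (univ.val.map y) (k := i.rev) (by simp)
  have hsub : n - (i.rev : ℕ) = i + 1 := by rw [Fin.val_rev]; omega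
  rw [Multiset.map_map, Multiset.card_map, card_val, card_univ, Fintype.card_fin, hsub,
    ← aeval_esymm_eq_multiset_esymm (Fin n) R] at hcoeff
  have hnodal : (nodal univ y).coeff i.rev = (-1) ^ (i + 1 : ℕ) * vietaMap y i := hcoeff
  simp [signedCoeffs, hnodal, ← mul_assoc, ← mul_pow, -Fin.val_rev]

theorem eq_zero_of_signedCoeffs_eq_zero {p : Polynomial R} (hp : p.degree < n)
    (h : signedCoeffs R n p = 0) : p = 0 := by
  ext j
  rcases lt_or_ge j n with hj | hj
  · simpa [signedCoeffs, -Fin.val_rev] using congrFun h (Fin.rev ⟨j, hj⟩)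
  · exact Polynomial.coeff_eq_zero_of_degree_lt (hp.trans_le (by exact_mod_cast hj))

theorem eval_aeval_esymm (y : Fin n → R) (g : MvPolynomial (Fin n) R) :
    eval y (aeval (fun i : Fin n => esymm (Fin n) R (i + 1)) g) = eval (vietaMap y) g :=
  comp_aeval_apply _ (aeval y) g

theorem exists_linearMap_vietaMap_eq_eval_esymm {m : ℕ} (hm : 0 < m) :
    ∃ e : (Fin n → R) →ₗ[R] R, ∀ y, e (vietaMap y) = eval y (esymm (Fin n) R m) := by
  rcases le_or_gt m n with hmn | hmn
  · refine ⟨LinearMap.proj ⟨m - 1, by omega⟩, fun y => ?_⟩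
    simp [vietaMap, Nat.sub_add_cancel hm]
  · refine ⟨0, fun y => ?_⟩
    rw [esymm, powersetCard_eq_empty.2 (by simpa using hmn), sum_empty, map_zero,
      LinearMap.zero_apply]

theorem sum_sq_eq_sq_sum_sub_esymm {σ : Type*} [Fintype σ] (y : σ → R) :
    ∑ i, y i ^ 2 = (∑ i, y i) ^ 2 - 2 * eval y (esymm σ R 2) := by
  classical
  have newton := congrArg (eval y) (mul_esymm_eq_sum σ R 2)
  have hindices : {a ∈ antidiagonal 2 | a.1 < 2} = {(0, 2), (1, 1)} := rfl
  rw [hindices, sum_pair (by decide)] at newton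
  simp only [psum, esymm_zero, esymm_one, map_mul, map_add, map_pow, map_neg, map_one, map_sum,
    eval_X, pow_one, pow_zero, Nat.cast_ofNat, map_ofNat] at newton
  linear_combination newton

end Vieta

theorem isCompact_setOf_sum_sq_le {ι : Type*} [Fintype ι] (r : ℝ) :
    IsCompact {y : ι → ℝ | ∑ i, y i ^ 2 ≤ r} := by
  refine (isCompact_univ_pi fun _ => isCompact_Icc (a := -√r) (b := √r)).of_isClosed_subset
    (isClosed_le (by fun_prop) continuous_const) fun y hy i _ => ?_
  exact abs_le.1 (Real.abs_le_sqrt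
    ((single_le_sum (fun j _ => sq_nonneg (y j)) (mem_univ i)).trans hy))

theorem exists_isMinOn_sum_sq {ι : Type*} [Fintype ι] {B : Set (ι → ℝ)} (hB : IsClosed B)
    (hne : B.Nonempty) : ∃ w ∈ B, IsMinOn (fun y => ∑ i, y i ^ 2) B w := by
  obtain ⟨x, hx⟩ := hne
  refine ContinuousOn.exists_isMinOn' (by fun_prop) hB hx (mem_inf_of_left ?_)
  filter_upwards [(isCompact_setOf_sum_sq_le (∑ i, x i ^ 2)).compl_mem_cocompact] with y hy
  exact (not_le.1 (show ¬∑ i, y i ^ 2 ≤ ∑ i, x i ^ 2 from hy)).le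

variable {n : ℕ}

theorem continuous_vietaMap : Continuous (vietaMap : (Fin n → ℝ) → Fin n → ℝ) :=
  continuous_pi fun _ => MvPolynomial.continuous_eval _

theorem extremePoints_range_vietaMap_inter_nonempty {A : Set (Fin n → ℝ)} (hA : IsClosed A)
    (hne : (Set.range vietaMap ∩ A).Nonempty) {c : ℝ}
    (hsum : ∀ y : Fin n → ℝ, vietaMap y ∈ A → ∑ i, y i = c) :
    ((Set.range vietaMap ∩ A).extremePoints ℝ).Nonempty := by
  obtain ⟨_, ⟨x, rfl⟩, hx⟩ := hne
  have hclosed : IsClosed (vietaMap ⁻¹' A) := hA.preimage continuous_vietaMap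
  obtain ⟨w, hwA, hw⟩ := exists_isMinOn_sum_sq hclosed ⟨x, hx⟩
  obtain ⟨e₂, he₂⟩ := exists_linearMap_vietaMap_eq_eval_esymm (R := ℝ) (n := n) two_pos
  have hsq : ∀ y ∈ vietaMap ⁻¹' A, ∑ i, y i ^ 2 = c ^ 2 - 2 * e₂ (vietaMap y) := fun y hy => by
    rw [sum_sq_eq_sq_sum_sub_esymm, hsum y hy, he₂]
  set F := e₂.toContinuousLinearMap.toExposed (Set.range vietaMap ∩ A)
  have hF : F = vietaMap '' (vietaMap ⁻¹' A ∩ {y | ∑ i, y i ^ 2 ≤ ∑ i, w i ^ 2}) := by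
    ext z
    constructor
    · rintro ⟨⟨⟨y, rfl⟩, hy⟩, hmax⟩
      have hwy : e₂ (vietaMap w) ≤ e₂ (vietaMap y) := hmax _ ⟨⟨w, rfl⟩, hwA⟩
      refine ⟨y, ⟨hy, ?_⟩, rfl⟩
      rw [Set.mem_ofPred, hsq y hy, hsq w hwA]
      linarith
    · rintro ⟨y, ⟨hy, hyw⟩, rfl⟩
      refine ⟨⟨⟨y, rfl⟩, hy⟩, ?_⟩
      rintro _ ⟨⟨u, rfl⟩, hu⟩
      have hyu : ∑ i, y i ^ 2 ≤ ∑ i, u i ^ 2 := le_trans hyw (hw hu)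
      rw [hsq y hy, hsq u hu] at hyu
      change e₂ _ ≤ e₂ _
      linarith
  have hFcompact : IsCompact F := by
    rw [hF]
    exact ((isCompact_setOf_sum_sq_le _).inter_left hclosed).image continuous_vietaMap
  have hFne : F.Nonempty := by
    rw [hF]
    exact ⟨_, w, ⟨hwA, le_refl (∑ i, w i ^ 2)⟩, rfl⟩
  exact (hFcompact.extremePoints_nonempty hFne).mono
    ContinuousLinearMap.toExposed.isExposed.isExtreme.extremePoints_subset_extremePoints

section Slice

theorem eventually_add_smul_signedCoeffs_mem_range_vietaMap {y : Fin n → ℝ} {s : Finset (Fin n)}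
    (hy : Set.InjOn y s) {S : Polynomial ℝ} (hS : S.degree < #s) :
    ∀ᶠ t in 𝓝 (0 : ℝ),
      vietaMap y + t • signedCoeffs ℝ n (nodal sᶜ y * S) ∈ Set.range vietaMap := by
  filter_upwards [eventually_exists_nodal_eq_add_smul hy hS] with t ⟨b, hb⟩
  have hsplit (z : Fin n → ℝ) : nodal univ z = nodal sᶜ z * nodal s z :=
    (prod_compl_mul_prod s _).symm
  have hcompl : nodal sᶜ (s.piecewise b y) = nodal sᶜ y :=
    prod_congr rfl fun i hi => by rw [piecewise_eq_of_notMem _ _ _ (mem_compl.1 hi)]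
  have hnodal : nodal s (s.piecewise b y) = nodal s b :=
    prod_congr rfl fun i hi => by rw [piecewise_eq_of_mem _ _ _ hi]
  refine ⟨s.piecewise b y, ?_⟩
  rw [← signedCoeffs_nodal, ← signedCoeffs_nodal, hsplit, hsplit y, hcompl, hnodal, hb, mul_add,
    mul_smul_comm, map_add, map_smul]

variable {W : Type*} [AddCommGroup W] [Module ℝ W] [FiniteDimensional ℝ W]
  (L : (Fin n → ℝ) →ₗ[ℝ] W)

theorem exists_direction_mem_ker_of_finrank_lt {y : Fin n → ℝ}
    (hy : finrank ℝ W < (Set.range y).ncard) :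
    ∃ v ≠ 0, L v = 0 ∧ ∀ᶠ t in 𝓝 (0 : ℝ), vietaMap y + t • v ∈ Set.range vietaMap := by
  classical
  obtain ⟨s, -, hinj, himage⟩ := exists_subset_injOn_image_eq_of_surjOn (f := y) Set.univ
    (univ.image y) (by simpa using Set.surjOn_image y Set.univ)
  have hcard : finrank ℝ W < finrank ℝ (Polynomial.degreeLT ℝ #s) := by
    rwa [(Polynomial.degreeLTEquiv ℝ #s).finrank_eq, finrank_fin_fun, ← card_image_of_injOn hinj,
      himage, ← Set.ncard_coe_finset, coe_image, coe_univ, Set.image_univ]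
  have := (Polynomial.degreeLTEquiv ℝ #s).symm.finiteDimensional
  let direction : Polynomial.degreeLT ℝ #s →ₗ[ℝ] (Fin n → ℝ) :=
    signedCoeffs ℝ n ∘ₗ LinearMap.mulLeft ℝ (nodal sᶜ y) ∘ₗ Submodule.subtype _
  obtain ⟨⟨S, hS⟩, hker, hne⟩ := Submodule.exists_mem_ne_zero_of_ne_bot
    (LinearMap.ker_ne_bot_of_finrank_lt (f := L ∘ₗ direction) hcard)
  rw [Polynomial.mem_degreeLT] at hS
  refine ⟨signedCoeffs ℝ n (nodal sᶜ y * S), fun h => hne (Subtype.ext ?_), hker,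
    eventually_add_smul_signedCoeffs_mem_range_vietaMap hinj hS⟩
  refine (mul_eq_zero_iff_left nodal_ne_zero).1 (eq_zero_of_signedCoeffs_eq_zero ?_ h)
  have hn : (n : WithBot ℕ) = #sᶜ + #s := by
    rw [← Nat.cast_add, card_compl_add_card, Fintype.card_fin]
  rw [Polynomial.degree_mul, degree_nodal, hn]
  exact WithBot.add_lt_add_left WithBot.coe_ne_bot hS

/-- The hyperbolic slice `L = c`: the set of monic polynomials of degree `n` with only real roots
whose coefficients satisfy the linear conditions `L = c`. A polynomial is encoded by its image under
`signedCoeffs`, which makes hyperbolic polynomials the range of the Vieta map. -/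
def hyperbolicSlice (c : W) : Set (Fin n → ℝ) :=
  Set.range vietaMap ∩ L ⁻¹' {c}

theorem mem_fewCoords_of_mem_extremePoints {c : W} {y : Fin n → ℝ}
    (hy : vietaMap y ∈ (hyperbolicSlice L c).extremePoints ℝ) :
    y ∈ fewCoords n (finrank ℝ W) := by
  by_contra hcard
  obtain ⟨v, hv, hLv, hmove⟩ := exists_direction_mem_ker_of_finrank_lt L (not_le.1 hcard)
  have hslice : ∀ᶠ t in 𝓝 (0 : ℝ), vietaMap y + t • v ∈ hyperbolicSlice L c := by
    filter_upwards [hmove] with t ht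
    exact ⟨ht, by simpa [hLv] using hy.1.2⟩
  have hlim : Tendsto (fun t : ℝ => -t) (𝓝 0) (𝓝 0) := continuous_neg.tendsto' _ _ neg_zero
  obtain ⟨t, ⟨hpos, hneg⟩, ht⟩ := (((hslice.and (hlim.eventually hslice)).filter_mono
    nhdsWithin_le_nhds).and (self_mem_nhdsWithin (s := {0}ᶜ))).exists
  have hmid : vietaMap y ∈ openSegment ℝ (vietaMap y + t • v) (vietaMap y + -t • v) :=
    ⟨1 / 2, 1 / 2, by norm_num, by norm_num, by norm_num, by module⟩
  have heq : vietaMap y + t • v = vietaMap y := hy.2 hpos hneg hmid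
  exact smul_ne_zero ht hv (add_eq_left.1 heq)

theorem exists_mem_fewCoords_finrank
    (hsum : ∀ y z : Fin n → ℝ, L (vietaMap y) = L (vietaMap z) → ∑ i, y i = ∑ i, z i)
    (x : Fin n → ℝ) : ∃ y ∈ fewCoords n (finrank ℝ W), L (vietaMap y) = L (vietaMap x) := by
  have hA : IsClosed (L ⁻¹' {L (vietaMap x)}) := by
    have hker : L ⁻¹' {L (vietaMap x)} = (fun z => z - vietaMap x) ⁻¹' L.ker := by
      ext z
      simp [sub_eq_zero]
    exact hker ▸ L.ker.closed_of_finiteDimensional.preimage (continuous_sub_right _)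
  obtain ⟨_, hz⟩ := extremePoints_range_vietaMap_inter_nonempty hA ⟨_, ⟨x, rfl⟩, rfl⟩
    fun y hy => hsum y x hy
  obtain ⟨⟨y, rfl⟩, hyL⟩ := hz.1
  exact ⟨y, mem_fewCoords_of_mem_extremePoints L hz, hyL⟩

theorem exists_mem_fewCoords_finrank_add_one (x : Fin n → ℝ) :
    ∃ y ∈ fewCoords n (finrank ℝ W + 1), L (vietaMap y) = L (vietaMap x) := by
  obtain ⟨e₁, he₁⟩ := exists_linearMap_vietaMap_eq_eval_esymm (R := ℝ) (n := n) one_pos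
  obtain ⟨y, hy, hyx⟩ := exists_mem_fewCoords_finrank (L.prod e₁) (fun y z h => by
    simpa [he₁, esymm_one] using congrArg Prod.snd h) x
  exact ⟨y, by simpa using hy, congrArg Prod.fst hyx⟩

end Slice

/-- The homogeneous component of degree one of a polynomial, as a linear functional. -/
noncomputable def linearPart {R σ : Type*} [CommSemiring R] [Fintype σ] :
    MvPolynomial σ R →ₗ[R] Dual R (σ → R) :=
  ∑ i, (MvPolynomial.lcoeff R (Finsupp.single i 1)).smulRight (LinearMap.proj i)

theorem linearPart_apply_of_isHomogeneous {R σ : Type*} [CommSemiring R] [Fintype σ]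
    {p : MvPolynomial σ R} (hp : p.IsHomogeneous 1) (v : σ → R) : linearPart p v = eval v p := by
  have hspan : p ∈ Submodule.span R (Set.range X) :=
    homogeneousSubmodule_one_eq_span_X (σ := σ) (R := R) ▸ hp
  refine LinearMap.eqOn_span (f := linearPart.flip v) (g := (aeval v).toLinearMap) ?_ hspan
  classical
  rintro _ ⟨i, rfl⟩
  simp [linearPart, coeff_X, Finsupp.single_left_inj]

theorem IsSufficient.eval_eq_of_linearPart_eq {k : ℕ} {l : Fin k → MvPolynomial (Fin n) ℝ}
    (hl : ∀ j, (l j).IsHomogeneous 1) {f : MvPolynomial (Fin n) ℝ} (hf : IsSufficient l f)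
    {x y : Fin n → ℝ} (h : ∀ j, linearPart (l j) (vietaMap y) = linearPart (l j) (vietaMap x)) :
    eval y f = eval x f := by
  obtain ⟨g, hg, rfl⟩ := hf
  rw [eval_aeval_esymm, eval_aeval_esymm]
  have hle : Algebra.adjoin ℝ (Set.range l) ≤
      AlgHom.equalizer (aeval (vietaMap y)) (aeval (R := ℝ) (vietaMap x)) := by
    refine Algebra.adjoin_le (Set.range_subset_iff.2 fun j => ?_)
    change eval (vietaMap y) (l j) = eval (vietaMap x) (l j)
    simpa only [linearPart_apply_of_isHomogeneous (hl j)] using h j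
  exact hle hg

theorem isValueComplete_of_forall_exists {m : ℕ} {f : MvPolynomial (Fin n) ℝ}
    (h : ∀ x, ∃ y ∈ fewCoords n m, eval y f = eval x f) : IsValueComplete m f := by
  refine Set.Subset.antisymm ?_ (Set.image_mono (Set.subset_univ _))
  rintro _ ⟨x, -, rfl⟩
  exact h x

end HyperbolicSlices

open HyperbolicSlices MvPolynomial Module in
theorem corollary3p9_general {n k : ℕ} {l : Fin k → MvPolynomial (Fin n) ℝ}
    (hl : ∀ j, (l j).IsHomogeneous 1) {f : MvPolynomial (Fin n) ℝ} (hf : IsSufficient l f) :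
    IsValueComplete (finrank ℝ (Submodule.span ℝ (Set.range l)) + 1) f ∧
      ∀ hn : 0 < n, X ⟨0, hn⟩ ∈ Submodule.span ℝ (Set.range l) →
        IsValueComplete (finrank ℝ (Submodule.span ℝ (Set.range l))) f := by
  set V := Submodule.span ℝ (Set.range l)
  have : FiniteDimensional ℝ V := FiniteDimensional.span_of_finite ℝ (Set.finite_range l)
  let L : (Fin n → ℝ) →ₗ[ℝ] Dual ℝ V := (linearPart.domRestrict V).flip
  have heval {x y : Fin n → ℝ} (h : L (vietaMap y) = L (vietaMap x)) : eval y f = eval x f :=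
    hf.eval_eq_of_linearPart_eq hl fun j =>
      LinearMap.congr_fun h ⟨l j, Submodule.subset_span ⟨j, rfl⟩⟩
  rw [← Subspace.dual_finrank_eq (K := ℝ) (V := V)]
  refine ⟨isValueComplete_of_forall_exists fun x => ?_,
    fun hn hX => isValueComplete_of_forall_exists fun x => ?_⟩
  · obtain ⟨y, hy, hyx⟩ := exists_mem_fewCoords_finrank_add_one L x
    exact ⟨y, hy, heval hyx⟩
  · have hsum (y z : Fin n → ℝ) (h : L (vietaMap y) = L (vietaMap z)) :
        ∑ i, y i = ∑ i, z i := by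
      have h0 : linearPart (X ⟨0, hn⟩) (vietaMap y) = linearPart (X ⟨0, hn⟩) (vietaMap z) :=
        LinearMap.congr_fun h ⟨_, hX⟩
      simpa [linearPart_apply_of_isHomogeneous (isHomogeneous_X ℝ _), vietaMap, esymm_one] using h0
    obtain ⟨y, hy, hyx⟩ := exists_mem_fewCoords_finrank L hsum x
    exact ⟨y, hy, heval hyx⟩

theorem corollary3p9 (n k : ℕ) (hk : 1 ≤ k) (hkn : k ≤ n)
    (l : Fin k → MvPolynomial (Fin n) ℝ)
    (hl : ∀ j, (l j).IsHomogeneous 1) (hli : LinearIndependent ℝ l)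
    (f : MvPolynomial (Fin n) ℝ) (hf : f.IsSymmetric)
    (hsuff : HyperbolicSlices.IsSufficient l f) :
    HyperbolicSlices.IsValueComplete (k + 1) f ∧
      ((MvPolynomial.X (⟨0, Nat.lt_of_lt_of_le hk hkn⟩ : Fin n) : MvPolynomial (Fin n) ℝ) ∈
          Submodule.span ℝ (Set.range l) →
        HyperbolicSlices.IsValueComplete k f) := by
  have h := corollary3p9_general hl hsuff
  rw [finrank_span_eq_card hli, Fintype.card_fin] at h
  exact ⟨h.1, h.2 _⟩
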